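/- Let $n\ge 1$ and $A\in\mathbb R^{n\times n}$, with vector inequalities read componentwise. For $q\in\mathbb R^n$ let $$\mathrm{SOL}(q,A)=\{z\in\mathbb R^n : z\ge 0,\ q+Az\ge 0,\ z^T(q+Az)=0\}$$ be the solution set of the linear complementarity problem $\mathrm{LCP}(q,A)$. The matrix $A$ is called *semimonotone* if for every $0\ne x\ge 0$ there is an index $i$ with $x_i>0$ and $(Ax)_i\ge 0$; it belongs to $E_0^s$ if it is semimonotone and, for every $x\ge 0$ with $Ax\ge 0$ and $x^TAx=0$, one has $A^Tx\le 0$; it belongs to $\tilde E_0^s$ if it belongs to $E_0^s$ and, for every $x\in\mathrm{SOL}(0,A)$ and every $i$, $(A^Tx)_i\ne 0$ implies $(Ax)_i\ne 0$. Let $$v(A)=\max_{x\in\Delta}\min_{y\in\Delta}\, y^TAx,\qquad \Delta=\Big\{x\in\mathbb R^n : x\ge 0,\ \sum_{i} x_i=1\Big\},$$ be the value of the two-person zero-sum matrix game with pay-off matrix $A$ (the column player maximizes). **Theorem.** If $A\in\tilde E_0^s$ and $v(A)>0$, then: 1. $A\in R_0\cap Q$, that is, $\mathrm{LCP}(0,A)$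 has a unique solution (namely $0$), and $\mathrm{SOL}(q,A)\neq\emptyset$ for every $q\in\mathbb R^n$; 2. $A\in Q_b$, that is, $\mathrm{SOL}(q,A)$ is nonempty and compact for every $q\in\mathbb R^n$. -/

import Mathlib

open scoped Matrix

namespace LCP

/-- `SOL(q, A)`: the vectors `z ≥ 0` with `q + A z ≥ 0` and `zᵀ (q + A z) = 0`, that is, the
`z`-parts of the solutions `(w, z)` of `w - A z = q`, `w ≥ 0`, `z ≥ 0`, `wᵀ z = 0`. -/
def SOL {n : ℕ} (q : Fin n → ℝ) (A : Matrix (Fin n) (Fin n) ℝ) : Set (Fin n → ℝ) :=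
  {z | 0 ≤ z ∧ 0 ≤ q + A *ᵥ z ∧ z ⬝ᵥ (q + A *ᵥ z) = 0}

/-- Semimonotone matrices, the class `E₀`. -/
def IsSemimonotone {n : ℕ} (A : Matrix (Fin n) (Fin n) ℝ) : Prop :=
  ∀ x : Fin n → ℝ, x ≠ 0 → 0 ≤ x → ∃ i, 0 < x i ∧ 0 ≤ (A *ᵥ x) i

/-- Semimonotone star matrices, the class `E₀ˢ`. -/
def IsSemimonotoneStar {n : ℕ} (A : Matrix (Fin n) (Fin n) ℝ) : Prop :=
  IsSemimonotone A ∧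
    ∀ x : Fin n → ℝ, x ⬝ᵥ (A *ᵥ x) = 0 → 0 ≤ A *ᵥ x → 0 ≤ x → Aᵀ *ᵥ x ≤ 0

/-- The class `Ẽ₀ˢ`. -/
def IsSemimonotoneStarTilde {n : ℕ} (A : Matrix (Fin n) (Fin n) ℝ) : Prop :=
  IsSemimonotoneStar A ∧
    ∀ x ∈ SOL 0 A, ∀ i, (Aᵀ *ᵥ x) i ≠ 0 → (A *ᵥ x) i ≠ 0

/-- The value of the two-person zero-sum matrix game with pay-off matrix `A`, both players using
mixed strategies; the player who picks the columns (strategy `x`) receives `yᵀ A x` from the player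
who picks the rows (strategy `y`), so that the value is `max_x min_y yᵀ A x`. -/
noncomputable def gameValue {n : ℕ} (A : Matrix (Fin n) (Fin n) ℝ) : ℝ :=
  ⨆ x : stdSimplex ℝ (Fin n), ⨅ y : stdSimplex ℝ (Fin n),
    y.1 ⬝ᵥ (A *ᵥ x.1)

/-- The class `R₀`: `LCP(0, A)` has a unique solution. -/
def IsR0 {n : ℕ} (A : Matrix (Fin n) (Fin n) ℝ) : Prop :=
  ∃! z : Fin n → ℝ, z ∈ SOL 0 A

/-- The class `Q`: `LCP(q, A)` has a solution for every `q`. -/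
def IsQ {n : ℕ} (A : Matrix (Fin n) (Fin n) ℝ) : Prop :=
  ∀ q : Fin n → ℝ, (SOL q A).Nonempty

/-- The class `Q_b`: `SOL(q, A)` is nonempty and compact for every `q`. -/
def IsQb {n : ℕ} (A : Matrix (Fin n) (Fin n) ℝ) : Prop :=
  ∀ q : Fin n → ℝ, (SOL q A).Nonempty ∧ IsCompact (SOL q A)

end LCP

namespace LCP

variable {n : ℕ}

/-! If `z` solves `LCP(0, A)`, the star condition gives `Aᵀ z ≤ 0`, while a positive game value
gives `x ≥ 0` with `A x > 0`. Then `zᵀ A x` is both `≤ 0` and `≥ 0`, which forces `z = 0`.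
Homogeneity and compactness of the sphere turn this into `c‖z‖ ≤ ‖min(z, A z)‖`, which bounds
solution sets and lets solvability pass to limits of perturbed problems.

Solvability is a parity count (`sum_card_tight_eq_zero`, `natCast_card_tight`). After perturbing `A`
to `A + ε I`, all complementary matrices are invertible. A generic half-line from `q` in a direction
`d > 0` crosses facets of complementary cones; each facet belongs to two cones, so the total count
is even. For a single cone the count is odd exactly when one of `q`, `d` is interior and the other
is not. Semimonotonicity puts `d` in the interior of the cone of `s = ∅` only, so `q` lies in an odd
number of cones. -/

/-! ### The min-residual: error bounds, compactness and stability. -/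

theorem mem_SOL_iff_inf_eq_zero (q : Fin n → ℝ) (A : Matrix (Fin n) (Fin n) ℝ) (z : Fin n → ℝ) :
    z ∈ SOL q A ↔ z ⊓ (q + A *ᵥ z) = 0 := by
  constructor
  · rintro ⟨hz, hw, h⟩
    ext i
    have hi : z i * (q + A *ᵥ z) i = 0 :=
      (Finset.sum_eq_zero_iff_of_nonneg fun j _ => mul_nonneg (hz j) (hw j)).1 h i
        (Finset.mem_univ i)
    have h1 := hz i
    have h2 := hw i
    rw [Pi.inf_apply]
    rcases mul_eq_zero.1 hi with h0 | h0
    · rw [h0]; exact inf_eq_left.2 h2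
    · rw [h0]; exact inf_eq_right.2 h1
  · intro h
    refine ⟨h ▸ inf_le_left, h ▸ inf_le_right, Finset.sum_eq_zero fun i _ => ?_⟩
    have hi := congrFun h i
    change min (z i) ((q + A *ᵥ z) i) = 0 at hi
    rcases min_choice (z i) ((q + A *ᵥ z) i) with h0 | h0
    · rw [← h0, hi, zero_mul]
    · rw [← h0, hi, mul_zero]

theorem continuous_residual (q : Fin n → ℝ) (A : Matrix (Fin n) (Fin n) ℝ) :
    Continuous fun z : Fin n → ℝ => z ⊓ (q + A *ᵥ z) := by
  have h : Continuous fun z : Fin n → ℝ => q + A *ᵥ z :=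
    continuous_const.add (Continuous.matrix_mulVec continuous_const continuous_id)
  exact continuous_pi fun i => (continuous_apply i).min ((continuous_apply i).comp h)

theorem isClosed_SOL (q : Fin n → ℝ) (A : Matrix (Fin n) (Fin n) ℝ) : IsClosed (SOL q A) := by
  have : SOL q A = (fun z : Fin n → ℝ => z ⊓ (q + A *ᵥ z)) ⁻¹' {0} := by
    ext z
    simp [mem_SOL_iff_inf_eq_zero]
  rw [this]
  exact isClosed_singleton.preimage (continuous_residual q A)

/-- The residual of `LCP(q, A)` at a solution of `LCP(q', A')` is at most the perturbation. -/
theorem norm_residual_le (q q' z : Fin n → ℝ) (A A' : Matrix (Fin n) (Fin n) ℝ)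
    (hz : z ∈ SOL q' A') :
    ‖z ⊓ (q + A *ᵥ z)‖ ≤ ‖(q + A *ᵥ z) - (q' + A' *ᵥ z)‖ := by
  rw [mem_SOL_iff_inf_eq_zero] at hz
  refine (pi_norm_le_iff_of_nonneg (norm_nonneg _)).2 fun i => ?_
  refine le_trans ?_ (norm_le_pi_norm _ i)
  have hi := congrFun hz i
  have h := abs_inf_sub_inf_le_abs ((q + A *ᵥ z) i) ((q' + A' *ᵥ z) i) (z i)
  rw [inf_comm, inf_comm _ (z i)] at h
  simp only [Pi.inf_apply, Pi.zero_apply] at hi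
  rw [hi, sub_zero] at h
  simpa [Real.norm_eq_abs] using h

/-- For an `R₀`-matrix the residual of `LCP(0, A)` dominates the norm. -/
theorem exists_residual_bound (A : Matrix (Fin n) (Fin n) ℝ) (h0 : ∀ z ∈ SOL 0 A, z = 0) :
    ∃ c > 0, ∀ z : Fin n → ℝ, c * ‖z‖ ≤ ‖z ⊓ (A *ᵥ z)‖ := by
  have hcont : Continuous fun z : Fin n → ℝ => ‖z ⊓ (A *ᵥ z)‖ := by
    simpa using (continuous_residual 0 A).norm
  -- The sphere is empty only when `n = 0`.
  rcases (Metric.sphere (0 : Fin n → ℝ) 1).eq_empty_or_nonempty with he | hne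
  · refine ⟨1, one_pos, fun z => ?_⟩
    have : z = 0 := by
      by_contra hz
      have : ‖z‖⁻¹ • z ∈ Metric.sphere (0 : Fin n → ℝ) 1 := by
        simp [norm_smul, norm_ne_zero_iff.2 hz]
      simp [he] at this
    simp [this]
  · obtain ⟨x, hx, hmin⟩ := (isCompact_sphere (0 : Fin n → ℝ) 1).exists_isMinOn hne
      hcont.continuousOn
    have hx1 : ‖x‖ = 1 := by simpa using hx
    refine ⟨‖x ⊓ (A *ᵥ x)‖, norm_pos_iff.2 fun h => ?_, fun z => ?_⟩
    · have := h0 x ((mem_SOL_iff_inf_eq_zero _ _ _).2 (by simpa using h))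
      simp [this] at hx1
    · by_cases hz : z = 0
      · simp [hz]
      have hz' : 0 < ‖z‖ := norm_pos_iff.2 hz
      have h1 : ‖x ⊓ (A *ᵥ x)‖ ≤ ‖(‖z‖⁻¹ • z) ⊓ (A *ᵥ (‖z‖⁻¹ • z))‖ :=
        hmin (by simp [norm_smul, hz'.ne'])
      have h2 : (‖z‖⁻¹ • z) ⊓ (A *ᵥ (‖z‖⁻¹ • z)) = ‖z‖⁻¹ • (z ⊓ (A *ᵥ z)) := by
        ext i
        simp only [Matrix.mulVec_smul, Pi.inf_apply, Pi.smul_apply, smul_eq_mul]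
        exact (mul_min_of_nonneg _ _ (inv_nonneg.2 hz'.le)).symm
      rw [h2, norm_smul, norm_inv, norm_norm] at h1
      calc _ ≤ ‖z‖⁻¹ * ‖z ⊓ A *ᵥ z‖ * ‖z‖ := mul_le_mul_of_nonneg_right h1 hz'.le
        _ = _ := by field_simp

theorem norm_le_of_mem_SOL_perturbed {A : Matrix (Fin n) (Fin n) ℝ} {c ε : ℝ} {q z : Fin n → ℝ}
    (hc : ∀ z : Fin n → ℝ, c * ‖z‖ ≤ ‖z ⊓ (A *ᵥ z)‖) (hε : 0 ≤ ε)
    (hz : z ∈ SOL q (A + ε • (1 : Matrix (Fin n) (Fin n) ℝ))) : (c - ε) * ‖z‖ ≤ ‖q‖ := by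
  have h := norm_residual_le 0 q z A _ hz
  have h1 : (0 + A *ᵥ z) - (q + (A + ε • (1 : Matrix (Fin n) (Fin n) ℝ)) *ᵥ z) = -(q + ε • z) := by
    simp [Matrix.add_mulVec, Matrix.smul_mulVec]
    abel
  rw [h1, norm_neg, zero_add] at h
  have h2 := norm_add_le q (ε • z)
  rw [norm_smul, Real.norm_of_nonneg hε] at h2
  linarith [hc z]

theorem isCompact_SOL {A : Matrix (Fin n) (Fin n) ℝ} (h0 : ∀ z ∈ SOL 0 A, z = 0)
    (q : Fin n → ℝ) : IsCompact (SOL q A) := by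
  obtain ⟨c, hc0, hc⟩ := exists_residual_bound A h0
  refine (isCompact_closedBall (0 : Fin n → ℝ) (‖q‖ / c)).of_isClosed_subset (isClosed_SOL q A)
    fun z hz => ?_
  have := norm_le_of_mem_SOL_perturbed (ε := 0) (q := q) hc le_rfl (by simpa using hz)
  rw [mem_closedBall_zero_iff, le_div_iff₀ hc0]
  linarith

/-- Solvability of arbitrarily small perturbations passes to an `R₀`-matrix. -/
theorem SOL_nonempty_of_perturbed {A : Matrix (Fin n) (Fin n) ℝ} (h0 : ∀ z ∈ SOL 0 A, z = 0)
    (q : Fin n → ℝ)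
    (H : ∀ δ > 0, ∃ ε : ℝ, 0 ≤ ε ∧ ε ≤ δ ∧ ∃ q' : Fin n → ℝ, ‖q' - q‖ ≤ δ ∧
      (SOL q' (A + ε • (1 : Matrix (Fin n) (Fin n) ℝ))).Nonempty) : (SOL q A).Nonempty := by
  obtain ⟨c, hc0, hc⟩ := exists_residual_bound A h0
  -- For `ε ≤ c / 2` and `‖q'‖ ≤ ‖q‖ + 1`, the bound `(c - ε)‖z‖ ≤ ‖q'‖` gives `‖z‖ ≤ R`.
  set R : ℝ := 2 * (‖q‖ + 1) / c with hR
  have hR0 : 0 ≤ R := by positivity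
  have key : ∀ δ > 0, δ ≤ 1 → δ ≤ c / 2 → ∃ z ∈ Metric.closedBall (0 : Fin n → ℝ) R,
      ‖z ⊓ (q + A *ᵥ z)‖ ≤ δ * (1 + R) := by
    intro δ hδ hδ1 hδc
    obtain ⟨ε, hε, hεδ, q', hq', z, hz⟩ := H δ hδ
    have hq1 : ‖q'‖ ≤ ‖q‖ + 1 := by
      have := norm_add_le (q' - q) q
      rw [sub_add_cancel] at this
      linarith
    have hzR : ‖z‖ ≤ R := by
      rw [hR, le_div_iff₀ hc0]
      have h1 := norm_le_of_mem_SOL_perturbed hc hε hz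
      nlinarith [norm_nonneg z]
    refine ⟨z, by simpa using hzR, ?_⟩
    refine (norm_residual_le q q' z A _ hz).trans ?_
    have h1 : (q + A *ᵥ z) - (q' + (A + ε • (1 : Matrix (Fin n) (Fin n) ℝ)) *ᵥ z)
        = -((q' - q) + ε • z) := by
      simp [Matrix.add_mulVec, Matrix.smul_mulVec]
      abel
    rw [h1, norm_neg]
    refine (norm_add_le _ _).trans ?_
    rw [norm_smul, Real.norm_of_nonneg hε]
    nlinarith [mul_le_mul hεδ hzR (norm_nonneg z) hδ.le]
  -- The residual attains its minimum on the ball and takes arbitrarily small values there, so the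
  -- minimum is zero.
  obtain ⟨x, -, hmin⟩ := (isCompact_closedBall (0 : Fin n → ℝ) R).exists_isMinOn
    ⟨0, by simpa using hR0⟩ (continuous_residual q A).norm.continuousOn
  refine ⟨x, (mem_SOL_iff_inf_eq_zero _ _ _).2 (norm_le_zero_iff.1 (le_of_forall_pos_le_add ?_))⟩
  intro η hη
  obtain ⟨z, hzR, hz⟩ := key (min (η / (1 + R)) (min 1 (c / 2)))
    (by positivity) ((min_le_right _ _).trans (min_le_left _ _))
    ((min_le_right _ _).trans (min_le_right _ _))
  have h1 : ‖x ⊓ (q + A *ᵥ x)‖ ≤ ‖z ⊓ (q + A *ᵥ z)‖ := hmin hzR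
  have h2 : min (η / (1 + R)) (min 1 (c / 2)) * (1 + R) ≤ η / (1 + R) * (1 + R) :=
    mul_le_mul_of_nonneg_right (min_le_left _ _) (by positivity)
  rw [div_mul_cancel₀ _ (by positivity)] at h2
  linarith

/-! ### The game value and the `R₀` property. -/

theorem exists_pos_mulVec_of_gameValue_pos {A : Matrix (Fin n) (Fin n) ℝ}
    (hv : 0 < gameValue A) : ∃ x : Fin n → ℝ, 0 ≤ x ∧ ∀ i, 0 < (A *ᵥ x) i := by
  unfold gameValue at hv
  by_contra! hcon
  refine hv.not_ge (Real.iSup_nonpos fun x => ?_)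
  obtain ⟨i, hi⟩ := hcon x.1 x.2.1
  by_cases hb : BddBelow (Set.range fun y : stdSimplex ℝ (Fin n) => y.1 ⬝ᵥ (A *ᵥ x.1))
  · refine (ciInf_le hb ⟨Pi.single i 1, single_mem_stdSimplex ℝ i⟩).trans ?_
    simpa using hi
  -- A real infimum that is unbounded below is `0` by convention.
  · exact (Real.iInf_of_not_bddBelow hb).le

theorem IsSemimonotoneStar.eq_zero_of_mem_SOL {A : Matrix (Fin n) (Fin n) ℝ}
    (hA : IsSemimonotoneStar A) (hv : 0 < gameValue A) :
    ∀ z ∈ SOL 0 A, z = 0 := by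
  rintro z ⟨hz, hw, h⟩
  rw [zero_add] at hw h
  have hT := hA.2 z h hw hz
  obtain ⟨x, hx, hAx⟩ := exists_pos_mulVec_of_gameValue_pos hv
  have h1 : z ⬝ᵥ (A *ᵥ x) ≤ 0 := by
    rw [Matrix.dotProduct_mulVec, ← Matrix.mulVec_transpose]
    exact Finset.sum_nonpos fun i _ => mul_nonpos_of_nonpos_of_nonneg (hT i) (hx i)
  have h2 : ∀ i ∈ Finset.univ, 0 ≤ z i * (A *ᵥ x) i := fun i _ => mul_nonneg (hz i) (hAx i).le
  ext i
  have := (Finset.sum_eq_zero_iff_of_nonneg h2).1 (le_antisymm h1 (Finset.sum_nonneg h2)) i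
    (Finset.mem_univ i)
  exact (mul_eq_zero.1 this).resolve_right (hAx i).ne'

/-! ### Parity of boundary crossings of a half-line with an orthant. -/

open Filter Topology

section Parity

variable {ι : Type*} [Fintype ι]

theorem eventually_forall_pos_add_mul (a v : ι → ℝ) (h : ∀ j, 0 < a j ∨ a j = 0 ∧ 0 < v j) :
    ∀ᶠ t : ℝ in 𝓝[>] 0, ∀ j, 0 < a j + t * v j := by
  refine eventually_all.2 fun j => ?_
  rcases h j with hj | ⟨h0, hj⟩
  · have : Tendsto (fun t : ℝ => a j + t * v j) (𝓝 0) (𝓝 (a j + 0 * v j)) :=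
      Continuous.tendsto (by fun_prop) 0
    rw [zero_mul, add_zero] at this
    exact (this.eventually (lt_mem_nhds hj)).filter_mono nhdsWithin_le_nhds
  · filter_upwards [self_mem_nhdsWithin] with t ht
    rw [h0, zero_add]
    exact mul_pos ht hj

open Classical in
/-- The constraints `0 ≤ u i + t * v i` that are tight at the left end of
`{t > 0 | 0 ≤ u + t • v}`. -/
noncomputable def entering (u v : ι → ℝ) : Finset ι :=
  {i | 0 < v i ∧ u i < 0 ∧ ∀ j, 0 ≤ u j * v i - u i * v j}

open Classical in
/-- The constraints `0 ≤ u i + t * v i` that are tight at an end of `{t > 0 | 0 ≤ u + t • v}`. -/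
noncomputable def tight (u v : ι → ℝ) : Finset ι :=
  {i | ∃ t > 0, u i + t * v i = 0 ∧ ∀ j, 0 ≤ u j + t * v j}

/-- A tight constraint with `v i > 0` marks the left end, one with `v i < 0` the right end. The
substitution `t ↦ t⁻¹` exchanges `u` with `v` and the right end with the left. -/
theorem card_tight (u v : ι → ℝ) (hv : ∀ i, v i ≠ 0) :
    (tight u v).card = (entering u v).card + (entering v u).card := by
  classical
  rw [← Finset.card_union_of_disjoint]
  · congr 1
    ext i
    simp only [tight, entering, Finset.mem_union, Finset.mem_filter, Finset.mem_univ, true_and]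
    constructor
    · rintro ⟨t, ht, hi, h⟩
      have hu : u i = -t * v i := by linarith
      rcases (hv i).lt_or_gt with hneg | hpos
      · refine Or.inr ⟨by rw [hu]; nlinarith, hneg, fun j => ?_⟩
        have : v j * u i - v i * u j = -v i * (u j + t * v j) := by rw [hu]; ring
        rw [this]
        exact mul_nonneg (by linarith) (h j)
      · refine Or.inl ⟨hpos, by rw [hu]; nlinarith, fun j => ?_⟩
        have : u j * v i - u i * v j = v i * (u j + t * v j) := by rw [hu]; ring
        rw [this]
        exact mul_nonneg hpos.le (h j)
    · rintro (⟨hpos, hu, h⟩ | ⟨hu, hneg, h⟩)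
      · refine ⟨-u i / v i, div_pos (by linarith) hpos, by field_simp; ring, fun j => ?_⟩
        have : u j + -u i / v i * v j = (u j * v i - u i * v j) / v i := by field_simp; ring
        rw [this]
        exact div_nonneg (h j) hpos.le
      · have hne : v i ≠ 0 := hneg.ne
        refine ⟨-u i / v i, div_pos_of_neg_of_neg (by linarith) hneg, by field_simp; ring,
          fun j => ?_⟩
        have : u j + -u i / v i * v j = (v j * u i - v i * u j) / (-v i) := by
          rw [div_neg]; field_simp; ring
        rw [this]
        exact div_nonneg (h j) (by linarith)
  · refine Finset.disjoint_left.2 fun i h1 h2 => ?_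
    simp only [entering, Finset.mem_filter, Finset.mem_univ, true_and] at h1 h2
    linarith [h1.1, h2.2.1]

open Classical in
-- By `h`, no two coordinates vanish at the same `t`, so the half-line enters through at most one
-- facet. It does so exactly when it starts outside the open orthant and meets it later.
theorem card_entering (u v : ι → ℝ) (hu : ∀ i, u i ≠ 0) (hv : ∀ i, v i ≠ 0)
    (h : ∀ i j, i ≠ j → u i * v j ≠ u j * v i) :
    (if ∀ i, 0 < u i then 1 else 0) + (entering u v).card =
      if ∃ t > 0, ∀ j, 0 < u j + t * v j then 1 else 0 := by
  have hmem : ∀ i, i ∈ entering u v ↔ 0 < v i ∧ u i < 0 ∧ ∀ j, 0 ≤ u j * v i - u i * v j := by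
    simp [entering]
  by_cases hupos : ∀ i, 0 < u i
  · have hE : entering u v = ∅ :=
      Finset.eq_empty_of_forall_notMem fun i hi => (hupos i).not_gt ((hmem i).1 hi).2.1
    have hex : ∃ t > 0, ∀ j, 0 < u j + t * v j := by
      obtain ⟨t, ht, ht0⟩ :=
        ((eventually_forall_pos_add_mul u v fun j => Or.inl (hupos j)).and
          self_mem_nhdsWithin).exists
      exact ⟨t, ht0, ht⟩
    rw [if_pos hupos, if_pos hex, hE, Finset.card_empty]
  rw [if_neg hupos, zero_add]
  split_ifs with hex
  · obtain ⟨t, ht, hpos⟩ := hex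
    push Not at hupos
    obtain ⟨k, hk⟩ := hupos
    have hvpos : ∀ j, u j < 0 → 0 < v j := fun j hj => by
      by_contra! hc
      nlinarith [hpos j]
    -- The entering constraint is the negative coordinate that is last to reach zero.
    obtain ⟨i, hi, hmax⟩ := Finset.exists_max_image (Finset.univ.filter fun j => u j < 0)
      (fun j => -u j / v j) ⟨k, by simpa using hk.lt_of_ne (hu k)⟩
    simp only [Finset.mem_filter, Finset.mem_univ, true_and] at hi hmax
    have hvi := hvpos i hi
    rw [Finset.card_eq_one]
    refine ⟨i, Finset.eq_singleton_iff_unique_mem.2 ⟨(hmem i).2 ⟨hvi, hi, fun j => ?_⟩, ?_⟩⟩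
    · rcases (hu j).lt_or_gt with hj | hj
      · have := hmax j hj
        rw [div_le_div_iff₀ (hvpos j hj) hvi] at this
        linarith
      · rcases (hv j).lt_or_gt with hj' | hj'
        · have h1 := hpos i
          have h2 := hpos j
          nlinarith [mul_pos h2 hvi, mul_pos h1 (neg_pos.2 hj')]
        · nlinarith [mul_pos hj hvi, mul_pos hj' (neg_pos.2 hi)]
    · intro j hj
      by_contra hne
      obtain ⟨hj1, hj2, hj3⟩ := (hmem j).1 hj
      have h1 := hmax j hj2
      rw [div_le_div_iff₀ hj1 hvi] at h1
      have h2 := hj3 i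
      exact h i j (Ne.symm hne) (by linarith)
  · refine Finset.card_eq_zero.2 (Finset.eq_empty_of_forall_notMem fun i hi => hex ?_)
    obtain ⟨h1, h2, h3⟩ := (hmem i).1 hi
    have hr : 0 < -u i / v i := div_pos (by linarith) h1
    -- At `t = -u i / v i` only coordinate `i` vanishes, and it is increasing, so slightly later all
    -- are positive.
    have key := eventually_forall_pos_add_mul (fun j => u j + -u i / v i * v j) v fun j => by
      by_cases hji : j = i
      · subst hji
        exact Or.inr ⟨by field_simp; ring, h1⟩
      · left
        have : u j + -u i / v i * v j = (u j * v i - u i * v j) / v i := by field_simp; ring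
        rw [this]
        refine div_pos ((h3 j).lt_of_ne fun h0 => h i j (Ne.symm hji) (by linarith)) h1
    obtain ⟨t, ht, ht0⟩ := (key.and self_mem_nhdsWithin).exists
    exact ⟨-u i / v i + t, add_pos hr ht0, fun j => by linarith [ht j]⟩

open Classical in
/-- The half-line `u + t • v`, `t > 0`, meets the boundary of the positive orthant (within the
orthant) in an odd number of points if and only if exactly one of its two ends lies inside. -/
theorem natCast_card_tight (u v : ι → ℝ) (hu : ∀ i, u i ≠ 0) (hv : ∀ i, v i ≠ 0)
    (h : ∀ i j, i ≠ j → u i * v j ≠ u j * v i) :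
    ((tight u v).card : ZMod 2) =
      (if ∀ i, 0 < u i then 1 else 0) + (if ∀ i, 0 < v i then 1 else 0) := by
  have h1 := card_entering u v hu hv h
  have h2 := card_entering v u hv hu fun i j hij he => h j i hij.symm (by linarith)
  have h3 : (∃ t > 0, ∀ j, 0 < v j + t * u j) ↔ ∃ t > 0, ∀ j, 0 < u j + t * v j := by
    have aux : ∀ a b : ι → ℝ, (∃ t > 0, ∀ j, 0 < a j + t * b j) →
        ∃ t > 0, ∀ j, 0 < b j + t * a j := by
      rintro a b ⟨t, ht, hj⟩
      refine ⟨t⁻¹, inv_pos.2 ht, fun j => ?_⟩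
      have : b j + t⁻¹ * a j = t⁻¹ * (a j + t * b j) := by field_simp; ring
      rw [this]
      exact mul_pos (inv_pos.2 ht) (hj j)
    exact ⟨aux v u, aux u v⟩
  rw [if_congr h3 rfl rfl, ← h1] at h2
  rw [card_tight u v hv]
  have h4 := congrArg (Nat.cast : ℕ → ZMod 2) h2
  have two : (2 : ZMod 2) = 0 := rfl
  push_cast at h4 ⊢
  linear_combination h4 + (entering u v).card * two - (if ∀ i, 0 < v i then 1 else 0) * two

end Parity

/-! ### Generic choices and complementary cones. -/

theorem exists_norm_sub_lt_forall_ne_zero {E ι : Type*} [NormedAddCommGroup E] [NormedSpace ℝ E]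
    [Finite ι] (f : ι → Module.Dual ℝ E) (hf : ∀ i, ∃ x, f i x ≠ 0) (p : E) {δ : ℝ} (hδ : 0 < δ) :
    ∃ x, ‖x - p‖ < δ ∧ ∀ i, f i x ≠ 0 := by
  obtain ⟨x₀, hx₀⟩ := Module.Dual.exists_forall_ne_zero_of_forall_exists f hf
  have hfin : (⋃ i, {ε : ℝ | f i (p + ε • x₀) = 0}).Finite := by
    refine Set.finite_iUnion fun i => Set.Subsingleton.finite fun a ha b hb => ?_
    simp only [Set.mem_ofPred_eq, map_add, map_smul, smul_eq_mul] at ha hb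
    exact mul_right_cancel₀ (hx₀ i) (by linarith)
  have hη : 0 < δ / (‖x₀‖ + 1) := by positivity
  obtain ⟨ε, hε, hbad⟩ := ((Set.Ioo_infinite hη).sdiff hfin).nonempty
  simp only [Set.mem_iUnion, Set.mem_ofPred_eq, not_exists] at hbad
  refine ⟨p + ε • x₀, ?_, hbad⟩
  rw [add_sub_cancel_left, norm_smul, Real.norm_of_nonneg hε.1.le]
  have := (lt_div_iff₀ (by positivity)).1 hε.2
  nlinarith [hε.1]

/-- The complementary matrix of `s` in `[I, -A]`: column `j` is `-A_j` if `j ∈ s` and `e_j`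
otherwise. -/
def complementaryMatrix (A : Matrix (Fin n) (Fin n) ℝ) (s : Finset (Fin n)) :
    Matrix (Fin n) (Fin n) ℝ :=
  Matrix.of fun i j => if j ∈ s then -A i j else (1 : Matrix (Fin n) (Fin n) ℝ) i j

theorem complementaryMatrix_mulVec (A : Matrix (Fin n) (Fin n) ℝ) (s : Finset (Fin n))
    (x : Fin n → ℝ) :
    complementaryMatrix A s *ᵥ x =
      (fun i => if i ∈ s then 0 else x i) - A *ᵥ (fun i => if i ∈ s then x i else 0) := by
  have h : (fun i => if i ∈ s then 0 else x i) =
      (1 : Matrix (Fin n) (Fin n) ℝ) *ᵥ (fun i => if i ∈ s then 0 else x i) :=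
    (Matrix.one_mulVec _).symm
  rw [h]
  ext i
  simp only [complementaryMatrix, Matrix.mulVec, dotProduct, Matrix.of_apply, Pi.sub_apply,
    ← Finset.sum_sub_distrib]
  refine Finset.sum_congr rfl fun j _ => ?_
  split_ifs <;> ring

/-- The two matrices differ only in column `i`, so their cones share the facet `x i = 0`. -/
theorem complementaryMatrix_symmDiff_mulVec (A : Matrix (Fin n) (Fin n) ℝ) (s : Finset (Fin n))
    {i : Fin n} {x : Fin n → ℝ} (hx : x i = 0) :
    complementaryMatrix A (symmDiff s {i}) *ᵥ x = complementaryMatrix A s *ᵥ x := by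
  rw [complementaryMatrix_mulVec, complementaryMatrix_mulVec]
  congr 2
  · ext j
    by_cases hj : j = i
    · simp [hj, hx]
    · simp [Finset.mem_symmDiff, hj]
  · ext j
    by_cases hj : j = i
    · simp [hj, hx]
    · simp [Finset.mem_symmDiff, hj]

theorem mem_SOL_of_complementaryMatrix_mulVec {A : Matrix (Fin n) (Fin n) ℝ} {s : Finset (Fin n)}
    {x q : Fin n → ℝ} (hx : 0 ≤ x) (h : complementaryMatrix A s *ᵥ x = q) :
    (fun i => if i ∈ s then x i else 0) ∈ SOL q A := by
  rw [complementaryMatrix_mulVec, sub_eq_iff_eq_add] at h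
  unfold SOL
  rw [Set.mem_ofPred_eq, ← h]
  refine ⟨fun i => ?_, fun i => ?_, Finset.sum_eq_zero fun i _ => ?_⟩
  · have := hx i
    simp only
    split_ifs
    exacts [this, le_rfl]
  · have := hx i
    simp only
    split_ifs
    exacts [le_rfl, this]
  · simp only
    split_ifs <;> simp

/-- A semimonotone matrix has only the trivial solution for a positive right-hand side. -/
theorem IsSemimonotone.eq_zero_of_mem_SOL {A : Matrix (Fin n) (Fin n) ℝ} (hA : IsSemimonotone A)
    {d z : Fin n → ℝ} (hd : ∀ i, 0 < d i) (hz : z ∈ SOL d A) : z = 0 := by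
  by_contra hne
  obtain ⟨i, hi, hAi⟩ := hA z hne hz.1
  have h := congrFun ((mem_SOL_iff_inf_eq_zero _ _ _).1 hz) i
  have : 0 < min (z i) ((d + A *ᵥ z) i) := lt_min hi (add_pos_of_pos_of_nonneg (hd i) hAi)
  exact this.ne' h

/-- A kernel vector restricted to `s` is an eigenvector, with eigenvalue `-ε`, of `A` with its rows
outside `s` set to zero; there are finitely many eigenvalues. -/
theorem finite_setOf_det_complementaryMatrix_eq_zero (A : Matrix (Fin n) (Fin n) ℝ)
    (s : Finset (Fin n)) :
    {ε : ℝ | (complementaryMatrix (A + ε • (1 : Matrix (Fin n) (Fin n) ℝ)) s).det = 0}.Finite := by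
  set M : Matrix (Fin n) (Fin n) ℝ := Matrix.of fun i j => if i ∈ s then A i j else 0 with hM
  have hfin := (Module.End.finite_hasEigenvalue (Matrix.toLin' M)).preimage
    (f := fun ε : ℝ => -ε) neg_injective.injOn
  refine hfin.subset fun ε hε => ?_
  obtain ⟨x, hx0, hx⟩ := Matrix.exists_mulVec_eq_zero_iff.2 hε
  rw [complementaryMatrix_mulVec, sub_eq_zero] at hx
  set z : Fin n → ℝ := fun i => if i ∈ s then x i else 0 with hz
  refine Module.End.hasEigenvalue_of_hasEigenvector (x := z)
    (Module.End.hasEigenvector_iff.2 ⟨Module.End.mem_eigenspace_iff.2 ?_, fun h0 => hx0 ?_⟩)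
  · ext i
    rw [Matrix.toLin'_apply]
    have hMz : (M *ᵥ z) i = if i ∈ s then (A *ᵥ z) i else 0 := by
      simp only [hM, Matrix.mulVec, dotProduct, Matrix.of_apply]
      split_ifs <;> simp
    rw [hMz]
    have hi := congrFun hx i
    simp only [Matrix.add_mulVec, Matrix.smul_mulVec, Matrix.one_mulVec, Pi.add_apply,
      Pi.smul_apply, smul_eq_mul] at hi ⊢
    by_cases his : i ∈ s
    · rw [if_pos his] at hi ⊢
      linarith
    · simp [his, hz]
  · rw [h0, Matrix.mulVec_zero] at hx
    ext i
    by_cases his : i ∈ s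
    · simpa [hz, his] using congrFun h0 i
    · simpa [his] using congrFun hx i

/-- The coordinates of the basic solution for `s` as linear functionals of the right-hand side. -/
noncomputable def basicCoord (A : Matrix (Fin n) (Fin n) ℝ) (s : Finset (Fin n)) (i : Fin n) :
    Module.Dual ℝ (Fin n → ℝ) :=
  LinearMap.proj i ∘ₗ Matrix.mulVecLin (complementaryMatrix A s)⁻¹

theorem basicCoord_apply (A : Matrix (Fin n) (Fin n) ℝ) (s : Finset (Fin n)) (i : Fin n)
    (q : Fin n → ℝ) : basicCoord A s i q = ((complementaryMatrix A s)⁻¹ *ᵥ q) i := rfl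

theorem basicCoord_mulVec {A : Matrix (Fin n) (Fin n) ℝ} {s : Finset (Fin n)}
    (hs : (complementaryMatrix A s).det ≠ 0) (i : Fin n) (x : Fin n → ℝ) :
    basicCoord A s i (complementaryMatrix A s *ᵥ x) = x i := by
  rw [basicCoord_apply, Matrix.mulVec_mulVec, Matrix.nonsing_inv_mul _ (Ne.isUnit hs),
    Matrix.one_mulVec]

theorem complementaryMatrix_mulVec_basicCoord {A : Matrix (Fin n) (Fin n) ℝ} {s : Finset (Fin n)}
    (hs : (complementaryMatrix A s).det ≠ 0) (q : Fin n → ℝ) :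
    (complementaryMatrix A s *ᵥ fun i => basicCoord A s i q) = q := by
  change complementaryMatrix A s *ᵥ ((complementaryMatrix A s)⁻¹ *ᵥ q) = q
  rw [Matrix.mulVec_mulVec, Matrix.mul_nonsing_inv _ (Ne.isUnit hs), Matrix.one_mulVec]

/-! ### The parity count and solvability. -/

open Classical in
-- For fixed `i`, a crossing of facet `i` of the cone of `s` is also one for `symmDiff s {i}`; this
-- fixed-point-free involution cancels the sum mod 2.
theorem sum_card_tight_eq_zero {A : Matrix (Fin n) (Fin n) ℝ}
    (hB : ∀ s, (complementaryMatrix A s).det ≠ 0) (q d : Fin n → ℝ) :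
    ∑ s : Finset (Fin n),
      ((tight (fun i => basicCoord A s i q) (fun i => basicCoord A s i d)).card : ZMod 2) = 0 := by
  have h : ∀ s : Finset (Fin n),
      ((tight (fun i => basicCoord A s i q) (fun i => basicCoord A s i d)).card : ZMod 2) =
      ∑ i, if i ∈ tight (fun i => basicCoord A s i q) (fun i => basicCoord A s i d) then 1 else 0 :=
    fun s => by simp
  simp only [h]
  rw [Finset.sum_comm]
  refine Finset.sum_eq_zero fun i _ => ?_
  have hstep : ∀ s, i ∈ tight (fun i => basicCoord A s i q) (fun i => basicCoord A s i d) →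
      i ∈ tight (fun j => basicCoord A (symmDiff s {i}) j q)
        (fun j => basicCoord A (symmDiff s {i}) j d) := by
    intro s hs
    simp only [tight, Finset.mem_filter, Finset.mem_univ, true_and] at hs ⊢
    obtain ⟨t, ht, hi, hj⟩ := hs
    have key : ∀ j, basicCoord A (symmDiff s {i}) j q + t * basicCoord A (symmDiff s {i}) j d =
        basicCoord A s j q + t * basicCoord A s j d := by
      intro j
      have h1 : (complementaryMatrix A (symmDiff s {i}) *ᵥ
          fun j => basicCoord A s j (q + t • d)) = q + t • d := by
        rw [complementaryMatrix_symmDiff_mulVec _ _ (by simpa using hi)]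
        exact complementaryMatrix_mulVec_basicCoord (hB s) _
      have h2 := basicCoord_mulVec (hB (symmDiff s {i})) j fun j => basicCoord A s j (q + t • d)
      rw [h1] at h2
      simpa using h2
    exact ⟨t, ht, by rw [key, hi], fun j => by rw [key]; exact hj j⟩
  have hinv : ∀ s : Finset (Fin n), symmDiff (symmDiff s {i}) {i} = s := fun s =>
    symmDiff_symmDiff_cancel_right _ _
  refine Finset.sum_involution (fun s _ => symmDiff s {i}) (fun s _ => ?_) (fun s _ _ hs => ?_)
    (fun s _ => Finset.mem_univ _) (fun s _ => hinv s)
  · have hiff := Iff.intro (hstep s) fun hs => by simpa only [hinv] using hstep _ hs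
    rw [← if_congr hiff rfl rfl]
    split_ifs
    · rfl
    · rfl
  · have : ({i} : Finset (Fin n)) = ⊥ := symmDiff_eq_left.1 hs
    simp at this

open Classical in
/-- If all complementary matrices are invertible, a semimonotone matrix has a solvable linear
complementarity problem arbitrarily close to any given one. -/
theorem IsSemimonotone.exists_near_SOL_nonempty {A : Matrix (Fin n) (Fin n) ℝ}
    (hA : IsSemimonotone A) (hB : ∀ s, (complementaryMatrix A s).det ≠ 0) (q : Fin n → ℝ)
    {δ : ℝ} (hδ : 0 < δ) : ∃ q' : Fin n → ℝ, ‖q' - q‖ ≤ δ ∧ (SOL q' A).Nonempty := by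
  obtain ⟨d, hd1, hd⟩ := exists_norm_sub_lt_forall_ne_zero
    (fun p : Finset (Fin n) × Fin n => basicCoord A p.1 p.2)
    (fun p => ⟨_, by rw [basicCoord_mulVec (hB p.1) p.2 1]; simp⟩) 1 one_pos
  have hdpos : ∀ i, 0 < d i := fun i => by
    have := (norm_le_pi_norm (d - 1) i).trans_lt hd1
    rw [Real.norm_eq_abs, abs_lt, Pi.sub_apply, Pi.one_apply] at this
    linarith [this.1]
  -- Triples with `i = j` keep `q'` off the facet hyperplanes; those with `i ≠ j` keep the half-line
  -- from meeting two of them at once. Column `i` is a witness because coordinate `j` of `d` is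
  -- nonzero.
  obtain ⟨q', hq1, hq⟩ := exists_norm_sub_lt_forall_ne_zero
    (fun p : Finset (Fin n) × Fin n × Fin n =>
      if p.2.1 = p.2.2 then basicCoord A p.1 p.2.1 else
        basicCoord A p.1 p.2.2 d • basicCoord A p.1 p.2.1 -
          basicCoord A p.1 p.2.1 d • basicCoord A p.1 p.2.2)
    (fun p => ⟨complementaryMatrix A p.1 *ᵥ Pi.single p.2.1 1, by
      split_ifs with h
      · rw [basicCoord_mulVec (hB _)]; simp
      · rw [LinearMap.sub_apply, LinearMap.smul_apply, LinearMap.smul_apply,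
          basicCoord_mulVec (hB _), basicCoord_mulVec (hB _)]
        simpa [Ne.symm h] using hd (p.1, p.2.2)⟩) q hδ
  refine ⟨q', hq1.le, ?_⟩
  by_contra hno
  have hfeas : ∀ s, ¬ ∀ i, 0 < basicCoord A s i q' := fun s hs =>
    hno ⟨_, mem_SOL_of_complementaryMatrix_mulVec (fun i => (hs i).le)
      (complementaryMatrix_mulVec_basicCoord (hB s) q')⟩
  -- Semimonotonicity enters here: an interior representation of `d` with `s ≠ ∅` would yield a
  -- nonzero solution of `LCP(d, A)`.
  have hray : ∀ s, (∀ i, 0 < basicCoord A s i d) ↔ s = ∅ := by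
    intro s
    constructor
    · intro hs
      have h0 := hA.eq_zero_of_mem_SOL hdpos (mem_SOL_of_complementaryMatrix_mulVec
        (fun i => (hs i).le) (complementaryMatrix_mulVec_basicCoord (hB s) d))
      refine Finset.eq_empty_of_forall_notMem fun i hi => (hs i).ne' ?_
      simpa [hi] using congrFun h0 i
    · rintro rfl i
      have h1 : complementaryMatrix A ∅ = 1 := by
        ext i j
        simp [complementaryMatrix]
      rw [basicCoord_apply, h1]
      simpa using hdpos i
  have hsum := sum_card_tight_eq_zero hB q' d
  have hcard : ∀ s, ((tight (fun i => basicCoord A s i q')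
      (fun i => basicCoord A s i d)).card : ZMod 2) = if s = ∅ then 1 else 0 := by
    intro s
    have h := natCast_card_tight (fun i => basicCoord A s i q') (fun i => basicCoord A s i d)
      (fun i => by simpa using hq (s, i, i)) (fun i => hd (s, i)) fun i j hij he => by
        refine hq (s, i, j) ?_
        simp only [hij, if_false, LinearMap.sub_apply, LinearMap.smul_apply, smul_eq_mul]
        linarith
    rw [h, if_neg (hfeas s), zero_add]
    simp only [hray s]
  simp [hcard] at hsum

theorem IsSemimonotone.add_smul_one {A : Matrix (Fin n) (Fin n) ℝ} (hA : IsSemimonotone A) {ε : ℝ}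
    (hε : 0 ≤ ε) : IsSemimonotone (A + ε • (1 : Matrix (Fin n) (Fin n) ℝ)) := by
  intro x hx hx0
  obtain ⟨i, hi, hAi⟩ := hA x hx hx0
  refine ⟨i, hi, ?_⟩
  have : 0 ≤ (A *ᵥ x) i + ε * x i := add_nonneg hAi (mul_nonneg hε hi.le)
  simpa [Matrix.add_mulVec, Matrix.smul_mulVec] using this

/-- Semimonotone `R₀`-matrices are `Q`-matrices. -/
theorem IsSemimonotone.isQ {A : Matrix (Fin n) (Fin n) ℝ} (hA : IsSemimonotone A)
    (h0 : ∀ z ∈ SOL 0 A, z = 0) : IsQ A := by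
  refine fun q => SOL_nonempty_of_perturbed h0 q fun δ hδ => ?_
  have hfin := Set.finite_iUnion fun s => finite_setOf_det_complementaryMatrix_eq_zero A s
  -- Only finitely many `ε` make some complementary matrix singular.
  obtain ⟨ε, hε, hbad⟩ := ((Set.Ioo_infinite hδ).sdiff hfin).nonempty
  simp only [Set.mem_iUnion, Set.mem_ofPred_eq, not_exists] at hbad
  exact ⟨ε, hε.1.le, hε.2.le, (hA.add_smul_one hε.1.le).exists_near_SOL_nonempty hbad q hδ⟩

end LCP

theorem mainTheorem8 {n : ℕ} (A : Matrix (Fin n) (Fin n) ℝ)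
    (hA : LCP.IsSemimonotoneStarTilde A) (hv : 0 < LCP.gameValue A) :
    (LCP.IsR0 A ∧ LCP.IsQ A) ∧ LCP.IsQb A := by
  have h0 := hA.1.eq_zero_of_mem_SOL hv
  have hQ : LCP.IsQ A := hA.1.1.isQ h0
  exact ⟨⟨⟨0, ⟨le_rfl, by simp, by simp⟩, h0⟩, hQ⟩, fun q => ⟨hQ q, LCP.isCompact_SOL h0 q⟩⟩
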